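/- **Model.** Let $V$ be a static set of $n\ge 2$ anonymous nodes. In each round $r=0,1,2,\dots$ there is a simple undirected graph $\mathcal G_r$ on $V$ in which the edges at each node $v$ carry distinct port labels $0,\dots,\deg_r(v)-1$ (the two labels of an edge, and the labels in different rounds, are unrelated). The dynamic graph is *1-Interval Connected*: every $\mathcal G_r$ is connected; otherwise it is arbitrary. There are $k=n-1$ agents with identifiers $1,\dots,n-1$, placed arbitrarily on the nodes. An agent knows its own identifier but neither $n$ nor $k$; between rounds it keeps only a bit string (which initially encodes its identifier) and a bit saying whether it has terminated. In each synchronous round every agent that has not terminated (i) broadcasts a message, received by all agents in its connected component of $\mathcal G_r$ (global communication), (ii) computes, from its memory, the received messages and its 1-hop view (the port-labelled subgraph induced by its node and the neighbours, with the agents on each of these nodes), its new memory, whether to move and through which port, and whether to terminate, and (iii) moves. The running time is the number of rounds until the last agent has terminated. A node without agents is a *hole*; a node with at least two agents is a *multinode*. **DISP (one round).** In each connected component of the subgraph of $\mathcal G_r$ induced by the nodes with agents that contains a multinode, let $w_1$ be the multinode holding the least identifier among the agents on multinodes of that component, and let $w_1,w_2,\dots,w_p$ be a shortest path with $w_2,\dots,w_{p-1}$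 occupied and $w_p$ a hole (ties broken by least identifiers, and by the least port for the hole). For each $j<p$ the agent with least identifier on $w_j$ moves to $w_{j+1}$. **Algorithm.** In each round, every agent broadcasts its identifier and its 1-hop information, including the number of agents on its node. If an agent is on a multinode or hears of one, it executes one round of DISP. Otherwise it moves to a neighbouring hole (through the least port leading to a hole), if there is one, and terminates in this round. **Theorem.** There are constants $c,C>0$ such that for every $n\ge 2$ and every set $V$ of $n$ nodes: 1. for every 1-Interval Connected dynamic graph on $V$ and every initial placement of the $n-1$ agents, all agents terminate, the running time $t$ is at most $Cn$, every node of $V$ has been visited by at least one agent by then, and every agent uses at most $C\log_2 n$ bits of memory in every round. Moreover, at the beginning of the last round $t-1$ the agents are on pairwise distinct nodes, and during that round an agent moves into the remaining hole; 2. there are a 1-Interval Connected dynamic graph on $V$ and an initial placement for which the running time is at least $cn$. So the algorithm solves exploration with termination in $\Theta(n)$ rounds with $O(\log n)$ bits per agent. -/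

import Mathlib

/-! ## Dynamic port-labelled graphs -/

/-- A graph with port labels. The entry with index `p` of `nbrs v` is the neighbour of `v` behind
port `p`, so the ports of `v` are `0, …, deg v - 1` and the two labels of an edge are unrelated. -/
structure PortGraph (V : Type*) where
  graph : SimpleGraph V
  nbrs : V → List V
  nodup_nbrs : ∀ v, (nbrs v).Nodup
  mem_nbrs : ∀ v w, w ∈ nbrs v ↔ graph.Adj v w

/-- A dynamic graph: one port-labelled graph per round, on a static set of nodes. -/
abbrev DynamicGraph (V : Type*) := ℕ → PortGraph V

/-- `T`-Interval Connectivity: over any `T` consecutive rounds the common edges connect all nodes. -/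
def DynamicGraph.IntervalConnected {V : Type*} (G : DynamicGraph V) (T : ℕ) : Prop :=
  ∀ r : ℕ, (⨅ i : Fin T, (G (r + i)).graph).Connected

/-! ## Agents: 1-hop visibility, global communication, memory -/

/-- What an agent sees of the neighbour behind one of its ports. -/
structure NbrView where
  /-- identifiers of the agents on that neighbour; the neighbour is a hole iff this is empty -/
  agents : Finset ℕ
  /-- port, at the neighbour, of the edge back to the observer's node -/
  back : Option ℕ
  /-- entry `q`: port, at the neighbour, of its edge to the observer's neighbour behind port `q`
  (`none` if there is no such edge) -/
  across : List (Option ℕ)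

/-- The 1-hop view: the agents on the observer's own node (the observer included) and, port by port,
its neighbours, with the port-labelled subgraph that they induce. -/
structure LocalView where
  here : Finset ℕ
  nbrs : List NbrView

/-- The result of the Compute phase of a round. -/
structure Decision where
  /-- the content of the memory that is kept for the next round -/
  mem : List Bool
  /-- the port to leave through, `none` for staying -/
  move : Option ℕ
  /-- whether the agent terminates at the end of this round -/
  halt : Bool

/-- A deterministic algorithm, the same for all agents, all graphs and all numbers of agents. The only
thing an agent keeps between rounds is a bit string. Its identifier is available only through the
initial content of that string, and neither `n` nor `k` is. In every round an agent broadcasts a message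
and then decides from its memory, its 1-hop view and the messages received. -/
structure AgentAlgorithm where
  Msg : Type
  init : ℕ → List Bool
  broadcast : List Bool → LocalView → Msg
  compute : List Bool → LocalView → List Msg → Decision

/-- A configuration of `k` agents at the beginning of a round. Agent `i` has identifier `i + 1`. -/
structure Config (V : Type*) (k : ℕ) where
  pos : Fin k → V
  mem : Fin k → List Bool
  halted : Fin k → Bool

namespace Config

variable {V : Type*} {k : ℕ}

/-- The number of bits that agent `i` stores: its memory and one bit for being terminated or not. -/
def bits (c : Config V k) (i : Fin k) : ℕ := (c.mem i).length + 1

open Classical in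
/-- The identifiers of the agents on node `v`. -/
noncomputable def agentsAt (c : Config V k) (v : V) : Finset ℕ :=
  (Finset.univ.filter fun i => c.pos i = v).image fun i => (i : ℕ) + 1

open Classical in
/-- The 1-hop view from node `v` in the graph `H` of the current round. -/
noncomputable def viewAt (c : Config V k) (H : PortGraph V) (v : V) : LocalView where
  here := c.agentsAt v
  nbrs := (H.nbrs v).map fun w =>
    { agents := c.agentsAt w
      back := (H.nbrs w).idxOf? v
      across := (H.nbrs v).map fun u => (H.nbrs w).idxOf? u }

open Classical in
/-- Global communication: agent `i` receives the messages of all agents (itself included) that have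
not terminated and lie in its connected component of `H`, in the order of their identifiers. -/
noncomputable def received (A : AgentAlgorithm) (c : Config V k) (H : PortGraph V) (i : Fin k) :
    List A.Msg :=
  ((List.finRange k).filter fun j =>
      decide (c.halted j = false ∧ H.graph.Reachable (c.pos i) (c.pos j))).map
    fun j => A.broadcast (c.mem j) (c.viewAt H (c.pos j))

/-- What agent `i` computes in a round with graph `H`. -/
noncomputable def decision (A : AgentAlgorithm) (c : Config V k) (H : PortGraph V) (i : Fin k) :
    Decision :=
  A.compute (c.mem i) (c.viewAt H (c.pos i)) (c.received A H i)

/-- The node that is reached from `v` through port `p`. -/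
def moveFrom (H : PortGraph V) (v : V) : Option ℕ → V
  | none => v
  | some p => ((H.nbrs v)[p]?).getD v

/-- One synchronous Communicate–Compute–Move round. A terminated agent does nothing any more. -/
noncomputable def next (A : AgentAlgorithm) (c : Config V k) (H : PortGraph V) : Config V k where
  pos i := if c.halted i then c.pos i else moveFrom H (c.pos i) (c.decision A H i).move
  mem i := if c.halted i then c.mem i else (c.decision A H i).mem
  halted i := if c.halted i then true else (c.decision A H i).halt

end Config

namespace AgentAlgorithm

variable {V : Type*} {k : ℕ}

/-- The configuration at the beginning of round `r` (that is, after `r` rounds). -/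
noncomputable def run (A : AgentAlgorithm) (G : DynamicGraph V) (start : Fin k → V) : ℕ → Config V k
  | 0 => { pos := start, mem := fun i => A.init (i + 1), halted := fun _ => false }
  | r + 1 => (A.run G start r).next A (G r)

/-- The running time: `t` is the number of rounds until the last agent has terminated. -/
def RunningTime (A : AgentAlgorithm) (G : DynamicGraph V) (start : Fin k → V) (t : ℕ) : Prop :=
  IsLeast {s : ℕ | ∀ i, (A.run G start s).halted i = true} t

/-- Within the first `t` rounds every node is visited by at least one agent. -/
def ExploresBy (A : AgentAlgorithm) (G : DynamicGraph V) (start : Fin k → V) (t : ℕ) : Prop :=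
  ∀ v : V, ∃ r ≤ t, ∃ i, (A.run G start r).pos i = v

end AgentAlgorithm

/-! ## The subroutine DISP and the exploration algorithm -/

/-- The message that an agent broadcasts: its identifier and its 1-hop information. -/
structure Report where
  id : ℕ
  view : LocalView

namespace Report

/-- The number of agents on the sender's node. -/
def count (r : Report) : ℕ := r.view.here.card

/-- The sender has the least identifier on its node; such a report stands for the node. -/
def isLeader (r : Report) : Bool := decide (∀ j ∈ r.view.here, r.id ≤ j)

/-- The sender of `s` is on a neighbouring node. -/
def sees (r s : Report) : Bool := r.view.nbrs.any fun w => decide (s.id ∈ w.agents)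

/-- The port that leads to the sender of `s`. -/
def portTo (r s : Report) : ℕ := r.view.nbrs.findIdx fun w => decide (s.id ∈ w.agents)

end Report

/-- The smallest port that leads to a hole, if there is one. -/
def LocalView.holePort (w : LocalView) : Option ℕ := w.nbrs.findIdx? fun u => decide (u.agents = ∅)

namespace DISP

/-! In what follows `L` lists one report for each occupied node. -/

/-- From the node of `r` some hole is at most `j + 1` steps away along occupied nodes. -/
def nearHole (L : List Report) : ℕ → Report → Bool
  | 0, r => r.view.holePort.isSome
  | j + 1, r => nearHole L j r || L.any fun s => r.sees s && nearHole L j s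

/-- A shortest sliding path from the node of `r` along occupied nodes to a hole at most `j + 1` steps
away: for each node of the path except the hole, the least agent there and the port it takes. Ties are
broken by the least identifier for occupied nodes and by the least port for holes. -/
def slidingPath (L : List Report) : ℕ → Report → List (ℕ × ℕ)
  | 0, r =>
    match r.view.holePort with
    | none => []
    | some p => [(r.id, p)]
  | j + 1, r =>
    if nearHole L j r then slidingPath L j r
    else
      match L.find? fun s => r.sees s && nearHole L j s with
      | none => []
      | some s => (r.id, r.portTo s) :: slidingPath L j s

/-- A walk of at most `j` steps along occupied nodes leads from the node of `r` to that of `s`. -/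
def joined (L : List Report) : ℕ → Report → Report → Bool
  | 0, r, s => decide (r.id = s.id)
  | j + 1, r, s => joined L j r s || L.any fun u => r.sees u && joined L j u s

/-- The node of `r` is a multinode and holds the least agent among all agents on multinodes of its
connected component of the subgraph induced by the occupied nodes. -/
def isRoot (L : List Report) (r : Report) : Bool :=
  decide (1 < r.count) &&
    L.all fun s => !(decide (1 < s.count) && joined L L.length r s) || decide (r.id ≤ s.id)

/-- One round of DISP: in every connected component of occupied nodes that has a multinode, slide one
agent per node along one path from a multinode to a hole. The result is the port through which the agent
`a` moves, if it is to move. -/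
def port (reports : List Report) (a : ℕ) : Option ℕ :=
  let L := reports.filter Report.isLeader
  (((L.filter (isRoot L)).flatMap (slidingPath L L.length)).find?
    fun m => decide (m.1 = a)).map Prod.snd

end DISP

/-- The identifier that a memory content encodes in binary. -/
def decodeId (m : List Bool) : ℕ := m.foldr Nat.bit 0

/-- Exploration with termination. The memory holds the identifier only. As long as there is a multinode,
execute a round of DISP; otherwise move to a neighbouring hole, if there is one, and terminate. -/
def explorationAlgorithm : AgentAlgorithm where
  Msg := Report
  init a := Nat.bits a
  broadcast m w := ⟨decodeId m, w⟩
  compute m w msgs :=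
    if decide (1 < w.here.card) || msgs.any (fun r => decide (1 < r.count)) then
      { mem := m, move := DISP.port msgs (decodeId m), halt := false }
    else
      { mem := m, move := w.holePort, halt := true }

/-! Call a node occupied if it carries an agent. A round of DISP moves the least agent of every node
of a sliding path one step along the path. The multinode where the path starts keeps another agent,
and every later node of the path is entered from the preceding one; paths from different roots that
share a node agree from there on, because the least agent of a node has only one sliding path. Hence
the occupied nodes stay occupied, and the hole at the end of a path becomes occupied. While there
is a multinode, the number of occupied nodes therefore grows in every round, so the agents disperse
after at most `k - 1` rounds, and all of them notice this at the same time because of global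
communication. With `k = n - 1` a single hole is left, and by connectivity one of its neighbours
carries an agent, which enters it in the next and last round.

Conversely, only the least agent of a node can leave it in a round of DISP, so when all agents start
on the same node, dispersion takes exactly `k - 1` rounds on every dynamic graph. -/

namespace Config

variable {V : Type*} {k : ℕ}

theorem mem_agentsAt {c : Config V k} {v : V} {a : ℕ} :
    a ∈ c.agentsAt v ↔ ∃ i : Fin k, c.pos i = v ∧ (i : ℕ) + 1 = a := by
  simp [agentsAt]

theorem succ_mem_agentsAt {c : Config V k} {v : V} {i : Fin k} :
    (i : ℕ) + 1 ∈ c.agentsAt v ↔ c.pos i = v := by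
  simp [agentsAt, Fin.val_inj]

theorem agentsAt_eq_empty {c : Config V k} {v : V} :
    c.agentsAt v = ∅ ↔ v ∉ Set.range c.pos := by
  simp [Finset.eq_empty_iff_forall_notMem, mem_agentsAt]

/-- Agent `i` has the least identifier on its node. -/
def IsLeader (c : Config V k) (i : Fin k) : Prop := ∀ j, c.pos j = c.pos i → i ≤ j

theorem IsLeader.eq {c : Config V k} {i j : Fin k} (hi : c.IsLeader i) (hj : c.IsLeader j)
    (h : c.pos i = c.pos j) : i = j :=
  le_antisymm (hi j h.symm) (hj i h)

theorem exists_isLeader (c : Config V k) (i : Fin k) :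
    ∃ j, c.pos j = c.pos i ∧ c.IsLeader j := by
  obtain ⟨j, hj, hmin⟩ := wellFounded_lt.has_min {j | c.pos j = c.pos i} ⟨i, rfl⟩
  exact ⟨j, hj, fun a ha => not_lt.1 (hmin a (ha.trans hj))⟩

/-- Agent `i` shares its node with another agent. -/
def OnMultinode (c : Config V k) (i : Fin k) : Prop := ∃ j ≠ i, c.pos j = c.pos i

theorem exists_onMultinode_iff {c : Config V k} :
    (∃ i, c.OnMultinode i) ↔ ¬ Function.Injective c.pos := by
  simp only [OnMultinode, Function.not_injective_iff]
  exact exists_congr fun i => exists_congr fun j => by rw [and_comm, eq_comm, ne_comm]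

theorem one_lt_card_agentsAt_pos {c : Config V k} {i : Fin k} :
    1 < (c.agentsAt (c.pos i)).card ↔ c.OnMultinode i := by
  constructor
  · intro h
    obtain ⟨_, ha, hne⟩ := Finset.exists_mem_ne h (i + 1)
    obtain ⟨j, hj, rfl⟩ := mem_agentsAt.1 ha
    exact ⟨j, by rintro rfl; exact hne rfl, hj⟩
  · rintro ⟨j, hne, hj⟩
    exact Finset.one_lt_card.2 ⟨j + 1, succ_mem_agentsAt.2 hj, i + 1, succ_mem_agentsAt.2 rfl,
      fun h => hne (Fin.ext (Nat.succ_injective h))⟩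

theorem holePort_viewAt (c : Config V k) (H : PortGraph V) (v : V) :
    (c.viewAt H v).holePort = (H.nbrs v).findIdx? fun w => decide (c.agentsAt w = ∅) := by
  simp only [LocalView.holePort, viewAt, List.findIdx?_map, Function.comp_def]

theorem moveFrom_notMem_range_of_holePort_eq_some {c : Config V k} {H : PortGraph V} {v : V} {p : ℕ}
    (h : (c.viewAt H v).holePort = some p) : moveFrom H v (some p) ∉ Set.range c.pos := by
  rw [holePort_viewAt, List.findIdx?_eq_some_iff_getElem] at h
  obtain ⟨hlt, hhole, -⟩ := h
  rw [decide_eq_true_eq, agentsAt_eq_empty] at hhole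
  simpa [moveFrom, hlt] using hhole

theorem isSome_holePort_viewAt {c : Config V k} {H : PortGraph V} {v w : V}
    (hvw : H.graph.Adj v w) (hw : w ∉ Set.range c.pos) :
    (c.viewAt H v).holePort.isSome = true := by
  rw [holePort_viewAt, List.findIdx?_isSome, List.any_eq_true]
  exact ⟨w, (H.mem_nbrs v w).2 hvw, decide_eq_true (agentsAt_eq_empty.2 hw)⟩

/-- The report that agent `i` broadcasts when its memory encodes its identifier. -/
noncomputable def report (c : Config V k) (H : PortGraph V) (i : Fin k) : Report :=
  ⟨i + 1, c.viewAt H (c.pos i)⟩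

theorem report_id_inj {c : Config V k} {H : PortGraph V} {i j : Fin k} :
    (c.report H i).id = (c.report H j).id ↔ i = j := by
  simp [report, Fin.val_inj]

theorem one_lt_count_report {c : Config V k} {H : PortGraph V} {i : Fin k} :
    1 < (c.report H i).count ↔ c.OnMultinode i :=
  one_lt_card_agentsAt_pos

theorem isLeader_report {c : Config V k} {H : PortGraph V} {i : Fin k} :
    (c.report H i).isLeader = true ↔ c.IsLeader i := by
  rw [Report.isLeader, decide_eq_true_iff]
  simp [report, viewAt, mem_agentsAt, IsLeader]

theorem sees_report {c : Config V k} {H : PortGraph V} {i j : Fin k} :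
    (c.report H i).sees (c.report H j) = true ↔ H.graph.Adj (c.pos i) (c.pos j) := by
  simp only [Report.sees, report, viewAt, List.any_map, List.any_eq_true, Function.comp,
    ← H.mem_nbrs]
  constructor
  · rintro ⟨w, hw, hj⟩
    rwa [succ_mem_agentsAt.1 (of_decide_eq_true hj)]
  · exact fun h => ⟨c.pos j, h, decide_eq_true (succ_mem_agentsAt.2 rfl)⟩

theorem moveFrom_portTo {c : Config V k} {H : PortGraph V} {i j : Fin k}
    (h : H.graph.Adj (c.pos i) (c.pos j)) :
    moveFrom H (c.pos i) (some ((c.report H i).portTo (c.report H j))) = c.pos j := by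
  have hport : (c.report H i).portTo (c.report H j) =
      (H.nbrs (c.pos i)).findIdx fun w => decide ((j : ℕ) + 1 ∈ c.agentsAt w) := by
    simp only [Report.portTo, report, viewAt, List.findIdx_map]
    rfl
  have hlt : (H.nbrs (c.pos i)).findIdx (fun w => decide ((j : ℕ) + 1 ∈ c.agentsAt w)) <
      (H.nbrs (c.pos i)).length :=
    List.findIdx_lt_length_of_exists
      ⟨c.pos j, (H.mem_nbrs _ _).2 h, decide_eq_true (succ_mem_agentsAt.2 rfl)⟩
  have hpos := List.findIdx_getElem (w := hlt)
  rw [decide_eq_true_eq, succ_mem_agentsAt] at hpos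
  simp only [moveFrom, hport, List.getElem?_eq_getElem hlt, Option.getD_some, ← hpos]

end Config

namespace DISP

variable {L : List Report}

theorem nearHole_mono {j j' : ℕ} {r : Report} (hj : j ≤ j') (h : nearHole L j r = true) :
    nearHole L j' r = true := by
  induction j', hj using Nat.le_induction with
  | base => exact h
  | succ m _ ih => simp [nearHole, ih]

theorem slidingPath_eq_of_le {j j' : ℕ} {r : Report} (hj : j ≤ j') (h : nearHole L j r = true) :
    slidingPath L j' r = slidingPath L j r := by
  induction j', hj using Nat.le_induction with
  | base => rfl
  | succ m hm ih => simp [slidingPath, nearHole_mono hm h, ih]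

theorem slidingPath_eq_singleton_or_cons {j : ℕ} {r : Report} (h : nearHole L j r = true) :
    (∃ p, r.view.holePort = some p ∧ slidingPath L j r = [(r.id, p)]) ∨
      ∃ s ∈ L, ∃ i < j, r.sees s = true ∧ nearHole L i s = true ∧
        slidingPath L j r = (r.id, r.portTo s) :: slidingPath L i s := by
  induction j with
  | zero =>
    obtain ⟨p, hp⟩ := Option.isSome_iff_exists.1 h
    exact .inl ⟨p, hp, by simp [slidingPath, hp]⟩
  | succ j ih =>
    by_cases hj : nearHole L j r = true
    · rw [slidingPath_eq_of_le j.le_succ hj]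
      refine (ih hj).imp_right ?_
      rintro ⟨s, hs, i, hi, hpath⟩
      exact ⟨s, hs, i, hi.trans j.lt_succ_self, hpath⟩
    · simp only [nearHole, hj, Bool.false_or, List.any_eq_true] at h
      obtain ⟨s, hs⟩ := Option.isSome_iff_exists.1 (List.find?_isSome.2 h)
      have hsel : (r.sees s && nearHole L j s) = true := by simpa using List.find?_some hs
      obtain ⟨hsees, hnear⟩ := Bool.and_eq_true_iff.1 hsel
      exact .inr ⟨s, List.mem_of_find?_eq_some hs, j, j.lt_succ_self, hsees, hnear,
        by simp [slidingPath, hj, hs]⟩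

/-- From every occupied node a walk along occupied nodes leads to a hole, so that each of them has a
sliding path. Here `L` lists one report for each occupied node, and a shortest walk of this kind has
at most `L.length` steps. -/
def HoleReachable (L : List Report) : Prop := ∀ r ∈ L, nearHole L L.length r = true

/-- The sliding path from the node of `r` to a hole, of arbitrary length. -/
def slide (L : List Report) (r : Report) : List (ℕ × ℕ) := slidingPath L L.length r

theorem HoleReachable.slide_eq_singleton_or_cons (hL : HoleReachable L) {r : Report} (hr : r ∈ L) :
    (∃ p, r.view.holePort = some p ∧ slide L r = [(r.id, p)]) ∨
      ∃ s ∈ L, r.sees s = true ∧ slide L r = (r.id, r.portTo s) :: slide L s := by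
  refine (slidingPath_eq_singleton_or_cons (hL r hr)).imp_right ?_
  rintro ⟨s, hs, i, hi, hsees, hnear, hpath⟩
  exact ⟨s, hs, hsees, hpath.trans (by rw [slide, slidingPath_eq_of_le hi.le hnear])⟩

theorem HoleReachable.slide_induction (hL : HoleReachable L) {motive : Report → Prop}
    (exit : ∀ r ∈ L, ∀ p, r.view.holePort = some p → slide L r = [(r.id, p)] → motive r)
    (step : ∀ r ∈ L, ∀ s ∈ L, r.sees s = true → slide L r = (r.id, r.portTo s) :: slide L s →
      motive s → motive r) {r : Report} (hr : r ∈ L) : motive r := by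
  induction hn : (slide L r).length generalizing r with
  | zero => rcases hL.slide_eq_singleton_or_cons hr with ⟨p, -, h⟩ | ⟨s, -, -, h⟩ <;> simp [h] at hn
  | succ n ih =>
    rcases hL.slide_eq_singleton_or_cons hr with ⟨p, hp, h⟩ | ⟨s, hs, hsees, h⟩
    · exact exit r hr p hp h
    · exact step r hr s hs hsees h (ih hs (by simpa [h] using hn))

theorem HoleReachable.fst_eq_id_of_mem_head?_slide (hL : HoleReachable L) {r : Report} (hr : r ∈ L)
    {m : ℕ × ℕ} (hm : m ∈ (slide L r).head?) : m.1 = r.id := by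
  rcases hL.slide_eq_singleton_or_cons hr with ⟨p, -, h⟩ | ⟨s, -, -, h⟩
  all_goals
    rw [h, List.head?_cons, Option.mem_some_iff] at hm
    rw [← hm]

theorem HoleReachable.exists_mem_head?_slide (hL : HoleReachable L) {r : Report} (hr : r ∈ L)
    {m : ℕ × ℕ} : m ∈ slide L r → ∃ s ∈ L, m ∈ (slide L s).head? := by
  refine hL.slide_induction (motive := fun r => m ∈ slide L r → _)
    (fun r hr p _ h hm => ?_) (fun r hr s _ _ h ih hm => ?_) hr
  · exact ⟨r, hr, by simp_all⟩
  · rw [h, List.mem_cons] at hm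
    exact hm.elim (fun hm => ⟨r, hr, by simp [h, hm]⟩) ih

theorem HoleReachable.fst_eq_id_or_exists_mem_slide (hL : HoleReachable L) {r : Report} (hr : r ∈ L)
    {m : ℕ × ℕ} : m ∈ slide L r → m.1 = r.id ∨
      ∃ u ∈ L, ∃ s ∈ L, m.1 = s.id ∧ u.sees s = true ∧ (u.id, u.portTo s) ∈ slide L r := by
  refine hL.slide_induction (motive := fun r => m ∈ slide L r → m.1 = r.id ∨
    ∃ u ∈ L, ∃ s ∈ L, m.1 = s.id ∧ u.sees s = true ∧ (u.id, u.portTo s) ∈ slide L r)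
    (fun r _ p _ h hm => ?_) (fun r hr s hs hsees h ih hm => ?_) hr
  · exact .inl (by simp_all)
  · rw [h, List.mem_cons] at hm
    rcases hm with rfl | hm
    · exact .inl rfl
    · refine .inr ?_
      rcases ih hm with hid | ⟨u, hu, t, ht, hid, hut, hmem⟩
      · exact ⟨r, hr, s, hs, hid, hsees, by simp [h]⟩
      · exact ⟨u, hu, t, ht, hid, hut, by simp [h, hmem]⟩

theorem HoleReachable.exists_holePort_mem_slide (hL : HoleReachable L) {r : Report} (hr : r ∈ L) :
    ∃ s ∈ L, ∃ p, s.view.holePort = some p ∧ (s.id, p) ∈ slide L r := by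
  refine hL.slide_induction
    (motive := fun r => ∃ s ∈ L, ∃ p, s.view.holePort = some p ∧ (s.id, p) ∈ slide L r)
    (fun r hr p hp h => ?_) (fun r _ s _ _ h ih => ?_) hr
  · exact ⟨r, hr, p, hp, by simp [h]⟩
  · obtain ⟨u, hu, p, hp, hmem⟩ := ih
    exact ⟨u, hu, p, hp, by simp [h, hmem]⟩

/-- The moves that one round of DISP consists of, as pairs of an identifier and a port. -/
def moves (L : List Report) : List (ℕ × ℕ) := (L.filter (isRoot L)).flatMap (slide L)

theorem mem_moves {m : ℕ × ℕ} :
    m ∈ moves L ↔ ∃ r ∈ L, isRoot L r = true ∧ m ∈ slide L r := by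
  simp [moves, and_assoc]

theorem HoleReachable.exists_id_eq_of_mem_moves (hL : HoleReachable L) {m : ℕ × ℕ}
    (hm : m ∈ moves L) : ∃ s ∈ L, m.1 = s.id := by
  obtain ⟨r, hr, -, hm⟩ := mem_moves.1 hm
  obtain ⟨s, hs, hhead⟩ := hL.exists_mem_head?_slide hr hm
  exact ⟨s, hs, hL.fst_eq_id_of_mem_head?_slide hs hhead⟩

theorem HoleReachable.root_or_exists_mem_moves (hL : HoleReachable L) {m : ℕ × ℕ}
    (hm : m ∈ moves L) : (∃ r ∈ L, isRoot L r = true ∧ m.1 = r.id) ∨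
      ∃ u ∈ L, ∃ s ∈ L, m.1 = s.id ∧ u.sees s = true ∧ (u.id, u.portTo s) ∈ moves L := by
  obtain ⟨r, hr, hroot, hm⟩ := mem_moves.1 hm
  rcases hL.fst_eq_id_or_exists_mem_slide hr hm with hid | ⟨u, hu, s, hs, hid, hsees, hmem⟩
  · exact .inl ⟨r, hr, hroot, hid⟩
  · exact .inr ⟨u, hu, s, hs, hid, hsees, mem_moves.2 ⟨r, hr, hroot, hmem⟩⟩

theorem HoleReachable.injOn_fst_moves (hL : HoleReachable L)
    (hid : Set.InjOn Report.id {r | r ∈ L}) : Set.InjOn Prod.fst {m | m ∈ moves L} := by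
  intro m hm m' hm' heq
  obtain ⟨r, hr, -, hm⟩ := mem_moves.1 hm
  obtain ⟨r', hr', -, hm'⟩ := mem_moves.1 hm'
  obtain ⟨s, hs, hhead⟩ := hL.exists_mem_head?_slide hr hm
  obtain ⟨s', hs', hhead'⟩ := hL.exists_mem_head?_slide hr' hm'
  have hss' : s = s' := hid hs hs' <| by
    rw [← hL.fst_eq_id_of_mem_head?_slide hs hhead, heq,
      hL.fst_eq_id_of_mem_head?_slide hs' hhead']
  subst hss'
  exact Option.mem_unique hhead hhead'

theorem port_eq_some_iff {reports : List Report}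
    (hL : HoleReachable (reports.filter Report.isLeader))
    (hid : Set.InjOn Report.id {r | r ∈ reports.filter Report.isLeader}) {a p : ℕ} :
    port reports a = some p ↔ (a, p) ∈ moves (reports.filter Report.isLeader) := by
  set L := reports.filter Report.isLeader
  have hport : port reports a = ((moves L).find? fun m => decide (m.1 = a)).map Prod.snd := rfl
  rw [hport, Option.map_eq_some_iff]
  constructor
  · rintro ⟨m, hm, rfl⟩
    obtain rfl : m.1 = a := by simpa using List.find?_some hm
    exact List.mem_of_find?_eq_some hm
  · intro hm
    obtain ⟨m, hfind⟩ := Option.isSome_iff_exists.1 <|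
      List.find?_isSome (p := fun m => decide (m.1 = a)).2 ⟨_, hm, decide_eq_true rfl⟩
    have hfst : m.1 = a := by simpa using List.find?_some hfind
    have heq := hL.injOn_fst_moves hid (List.mem_of_find?_eq_some hfind) hm hfst
    exact ⟨m, hfind, by rw [heq]⟩

end DISP

namespace Config

open DISP

variable {V : Type*} {k : ℕ} {c : Config V k} {H : PortGraph V}

open Classical in
/-- The agents that have the least identifiers on their nodes; they stand for the occupied nodes. -/
noncomputable def leaders (c : Config V k) : List (Fin k) := (List.finRange k).filter (c.IsLeader ·)

theorem mem_leaders {i : Fin k} : i ∈ c.leaders ↔ c.IsLeader i := by simp [leaders]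

/-- The reports of the leaders, one for each occupied node: the list `L` on which DISP works. -/
noncomputable def leaderReports (c : Config V k) (H : PortGraph V) : List Report :=
  c.leaders.map (c.report H)

theorem filter_isLeader_map_report (c : Config V k) (H : PortGraph V) :
    ((List.finRange k).map (c.report H)).filter Report.isLeader = c.leaderReports H := by
  rw [List.filter_map, leaderReports, leaders]
  congr 1
  exact List.filter_congr fun i _ => by simp [← isLeader_report (H := H)]

theorem mem_leaderReports {r : Report} :
    r ∈ c.leaderReports H ↔ ∃ i, c.IsLeader i ∧ c.report H i = r := by
  simp [leaderReports, mem_leaders]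

theorem injOn_id_leaderReports (c : Config V k) (H : PortGraph V) :
    Set.InjOn Report.id {r | r ∈ c.leaderReports H} := by
  rintro r hr s hs hrs
  obtain ⟨i, -, rfl⟩ := mem_leaderReports.1 hr
  obtain ⟨j, -, rfl⟩ := mem_leaderReports.1 hs
  rw [report_id_inj.1 hrs]

open Classical in
theorem nearHole_length_filter_support {i : Fin k} (hi : c.IsLeader i) {h : V}
    (hh : h ∉ Set.range c.pos) (w : H.graph.Walk (c.pos i) h) :
    nearHole (c.leaderReports H) (w.support.filter (· ∈ Set.range c.pos)).length
      (c.report H i) = true := by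
  generalize hv : c.pos i = v at w
  induction w generalizing i with
  | nil => exact absurd ⟨i, hv⟩ hh
  | @cons v u h hvu w ih =>
    subst hv
    by_cases hu : u ∈ Set.range c.pos
    · obtain ⟨a, rfl⟩ := hu
      obtain ⟨s, hs, hsl⟩ := c.exists_isLeader a
      have hnear := ih hsl hh hs
      simp only [SimpleGraph.Walk.support_cons, Set.mem_range_self, decide_true,
        List.filter_cons_of_pos, List.length_cons, nearHole, Bool.or_eq_true, List.any_eq_true,
        Bool.and_eq_true]
      exact .inr ⟨c.report H s, mem_leaderReports.2 ⟨s, hsl, rfl⟩,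
        sees_report.2 (hs ▸ hvu), hnear⟩
    · exact nearHole_mono (Nat.zero_le _) (isSome_holePort_viewAt hvu hu)

open Classical in
theorem length_filter_mem_range_pos_le (c : Config V k) (H : PortGraph V) {l : List V}
    (hl : l.Nodup) : (l.filter (· ∈ Set.range c.pos)).length ≤ (c.leaderReports H).length := by
  have hsub : l.filter (· ∈ Set.range c.pos) ⊆ c.leaders.map c.pos := by
    intro v hv
    obtain ⟨i, rfl⟩ : v ∈ Set.range c.pos := by simpa using (List.mem_filter.1 hv).2
    obtain ⟨j, hj, hjl⟩ := c.exists_isLeader i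
    exact List.mem_map.2 ⟨j, mem_leaders.2 hjl, hj⟩
  simpa [leaderReports] using ((hl.filter _).subperm hsub).length_le

theorem holeReachable_leaderReports (hH : H.graph.Preconnected)
    (hc : ¬ Function.Surjective c.pos) : HoleReachable (c.leaderReports H) := by
  classical
  intro r hr
  obtain ⟨i, hi, rfl⟩ := mem_leaderReports.1 hr
  obtain ⟨h, hh⟩ := not_forall.1 hc
  obtain ⟨w, hw⟩ := (hH (c.pos i) h).exists_isPath
  exact nearHole_mono (c.length_filter_mem_range_pos_le H hw.support_nodup)
    (nearHole_length_filter_support hi hh w)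

/-- The port through which DISP moves agent `i`. -/
noncomputable def dispPort (c : Config V k) (H : PortGraph V) (i : Fin k) : Option ℕ :=
  DISP.port ((List.finRange k).map (c.report H)) (i + 1)

/-- The node of agent `i` after one round of DISP. -/
noncomputable def dispPos (c : Config V k) (H : PortGraph V) (i : Fin k) : V :=
  moveFrom H (c.pos i) (c.dispPort H i)

theorem dispPort_eq_some_iff (hL : HoleReachable (c.leaderReports H)) {i : Fin k} {p : ℕ} :
    c.dispPort H i = some p ↔ ((c.report H i).id, p) ∈ moves (c.leaderReports H) := by
  rw [← filter_isLeader_map_report] at hL ⊢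
  exact port_eq_some_iff hL (by rw [filter_isLeader_map_report]; exact c.injOn_id_leaderReports H)

theorem isLeader_of_dispPort_eq_some (hL : HoleReachable (c.leaderReports H)) {i : Fin k} {p : ℕ}
    (hp : c.dispPort H i = some p) : c.IsLeader i := by
  obtain ⟨s, hs, hid⟩ := hL.exists_id_eq_of_mem_moves ((dispPort_eq_some_iff hL).1 hp)
  obtain ⟨j, hj, rfl⟩ := mem_leaderReports.1 hs
  exact report_id_inj.1 hid ▸ hj

theorem dispPos_of_not_isLeader (hL : HoleReachable (c.leaderReports H)) {i : Fin k}
    (hi : ¬ c.IsLeader i) : c.dispPos H i = c.pos i := by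
  have hp : c.dispPort H i = none :=
    Option.eq_none_iff_forall_ne_some.2 fun _ hp => hi (isLeader_of_dispPort_eq_some hL hp)
  rw [dispPos, hp, moveFrom]

theorem onMultinode_or_exists_dispPos_eq (hL : HoleReachable (c.leaderReports H)) {i : Fin k}
    {p : ℕ} (hp : c.dispPort H i = some p) :
    c.OnMultinode i ∨ ∃ u, c.dispPos H u = c.pos i := by
  rcases hL.root_or_exists_mem_moves ((dispPort_eq_some_iff hL).1 hp) with
    ⟨r, hr, hroot, hid⟩ | ⟨r, hr, s, hs, hid, hsees, hmem⟩
  · obtain ⟨j, -, rfl⟩ := mem_leaderReports.1 hr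
    obtain rfl := report_id_inj.1 hid
    exact .inl (one_lt_count_report.1 (of_decide_eq_true (Bool.and_eq_true_iff.1 hroot).1))
  · obtain ⟨u, -, rfl⟩ := mem_leaderReports.1 hr
    obtain ⟨j, -, rfl⟩ := mem_leaderReports.1 hs
    obtain rfl := report_id_inj.1 hid
    refine .inr ⟨u, ?_⟩
    rw [dispPos, (dispPort_eq_some_iff hL).2 hmem, moveFrom_portTo (sees_report.1 hsees)]

theorem range_pos_subset_range_dispPos (hL : HoleReachable (c.leaderReports H)) :
    Set.range c.pos ⊆ Set.range (c.dispPos H) := by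
  rintro _ ⟨i, rfl⟩
  cases hp : c.dispPort H i with
  | none => exact ⟨i, by rw [dispPos, hp, moveFrom]⟩
  | some p =>
    rcases onMultinode_or_exists_dispPos_eq hL hp with ⟨j, hne, hj⟩ | hu
    · have hjl : ¬ c.IsLeader j := fun hjl =>
        hne (hjl.eq (isLeader_of_dispPort_eq_some hL hp) hj)
      exact ⟨j, (dispPos_of_not_isLeader hL hjl).trans hj⟩
    · exact hu

theorem exists_isRoot (hc : ¬ Function.Injective c.pos) :
    ∃ r ∈ c.leaderReports H, isRoot (c.leaderReports H) r = true := by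
  obtain ⟨i, hi, hmin⟩ := wellFounded_lt.has_min {i | c.OnMultinode i} (exists_onMultinode_iff.2 hc)
  replace hmin : ∀ j, c.OnMultinode j → i ≤ j := fun j hj => not_lt.1 (hmin j hj)
  have hleader : c.IsLeader i := by
    intro j hj
    by_cases hji : j = i
    · exact hji.ge
    · exact hmin j ⟨i, Ne.symm hji, hj.symm⟩
  refine ⟨c.report H i, mem_leaderReports.2 ⟨i, hleader, rfl⟩, ?_⟩
  rw [isRoot, Bool.and_eq_true, decide_eq_true_iff, one_lt_count_report, List.all_eq_true]
  refine ⟨hi, fun s hs => ?_⟩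
  obtain ⟨j, -, rfl⟩ := mem_leaderReports.1 hs
  by_cases hj : c.OnMultinode j
  · rw [Bool.or_eq_true]
    exact .inr (decide_eq_true (Nat.succ_le_succ (hmin j hj)))
  · simp [one_lt_count_report, hj]

theorem exists_dispPos_notMem_range_pos (hL : HoleReachable (c.leaderReports H))
    (hc : ¬ Function.Injective c.pos) : ∃ i, c.dispPos H i ∉ Set.range c.pos := by
  obtain ⟨r, hr, hroot⟩ := exists_isRoot (H := H) hc
  obtain ⟨s, hs, p, hhole, hmem⟩ := hL.exists_holePort_mem_slide hr
  obtain ⟨i, -, rfl⟩ := mem_leaderReports.1 hs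
  have hp : c.dispPort H i = some p :=
    (dispPort_eq_some_iff hL).2 (mem_moves.2 ⟨r, hr, hroot, hmem⟩)
  refine ⟨i, ?_⟩
  rw [dispPos, hp]
  exact moveFrom_notMem_range_of_holePort_eq_some hhole

theorem range_pos_ssubset_range_dispPos (hL : HoleReachable (c.leaderReports H))
    (hc : ¬ Function.Injective c.pos) : Set.range c.pos ⊂ Set.range (c.dispPos H) := by
  obtain ⟨i, hi⟩ := exists_dispPos_notMem_range_pos hL hc
  exact (range_pos_subset_range_dispPos hL).ssubset_of_mem_notMem ⟨i, rfl⟩ hi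

theorem ncard_pos_preimage_le (hL : HoleReachable (c.leaderReports H)) (v : V) :
    (c.pos ⁻¹' {v}).ncard ≤ (c.dispPos H ⁻¹' {v}).ncard + 1 := by
  rcases (c.pos ⁻¹' {v}).eq_empty_or_nonempty with hv | ⟨i, rfl⟩
  · simp [hv]
  · obtain ⟨a, ha, hal⟩ := c.exists_isLeader i
    refine (Set.ncard_le_ncard fun j hj => ?_).trans (Set.ncard_insert_le a _)
    by_cases hjl : c.IsLeader j
    · exact .inl (hjl.eq hal (hj.trans ha.symm))
    · exact .inr ((dispPos_of_not_isLeader hL hjl).trans hj)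

theorem decodeId_bits (a : ℕ) : decodeId (Nat.bits a) = a := by
  induction a using Nat.binaryRec' with
  | zero => simp [decodeId]
  | bit b m h ih =>
    rw [Nat.bits_append_bit _ _ h]
    simpa [decodeId] using congrArg (Nat.bit b) ih

/-- No agent has terminated, and every agent remembers exactly its identifier. -/
structure IsActive (c : Config V k) : Prop where
  mem : ∀ i : Fin k, c.mem i = Nat.bits (i + 1)
  halted : ∀ i, c.halted i = false

theorem IsActive.received_eq (hc : c.IsActive) (hH : H.graph.Preconnected) (i : Fin k) :
    c.received explorationAlgorithm H i = (List.finRange k).map (c.report H) := by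
  rw [received, List.filter_eq_self.2 fun j _ => by simpa using ⟨hc.halted j, hH _ _⟩]
  exact List.map_congr_left fun j _ => by
    simp [explorationAlgorithm, report, hc.mem, decodeId_bits]

theorem any_one_lt_count_report :
    ((List.finRange k).map (c.report H)).any (fun r => decide (1 < r.count)) = true ↔
      ¬ Function.Injective c.pos := by
  simp [one_lt_count_report, exists_onMultinode_iff]

theorem IsActive.decision_of_not_injective (hc : c.IsActive) (hH : H.graph.Preconnected)
    (hinj : ¬ Function.Injective c.pos) (i : Fin k) :
    c.decision explorationAlgorithm H i = ⟨c.mem i, c.dispPort H i, false⟩ := by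
  rw [decision, hc.received_eq hH]
  simp only [explorationAlgorithm]
  rw [any_one_lt_count_report.2 hinj, Bool.or_true, if_pos rfl, hc.mem, decodeId_bits, dispPort]

theorem IsActive.decision_of_injective (hc : c.IsActive) (hH : H.graph.Preconnected)
    (hinj : Function.Injective c.pos) (i : Fin k) :
    c.decision explorationAlgorithm H i = ⟨c.mem i, (c.viewAt H (c.pos i)).holePort, true⟩ := by
  have hany := Bool.eq_false_iff.2 fun h => any_one_lt_count_report (H := H).1 h hinj
  have hhere : ¬ 1 < (c.viewAt H (c.pos i)).here.card := fun h =>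
    exists_onMultinode_iff.1 ⟨i, one_lt_card_agentsAt_pos.1 h⟩ hinj
  rw [decision, hc.received_eq hH]
  simp only [explorationAlgorithm]
  rw [hany, Bool.or_false, if_neg (by simpa using hhere)]

theorem IsActive.next (hc : c.IsActive) (hH : H.graph.Preconnected)
    (hinj : ¬ Function.Injective c.pos) : (c.next explorationAlgorithm H).IsActive where
  mem i := by simp [Config.next, hc.halted, hc.decision_of_not_injective hH hinj, hc.mem]
  halted i := by simp [Config.next, hc.halted, hc.decision_of_not_injective hH hinj]

theorem IsActive.pos_next (hc : c.IsActive) (hH : H.graph.Preconnected)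
    (hinj : ¬ Function.Injective c.pos) :
    (c.next explorationAlgorithm H).pos = c.dispPos H := by
  funext i
  simp [Config.next, hc.halted, hc.decision_of_not_injective hH hinj, dispPos]

theorem IsActive.halted_next (hc : c.IsActive) (hH : H.graph.Preconnected)
    (hinj : Function.Injective c.pos) (i : Fin k) :
    (c.next explorationAlgorithm H).halted i = true := by
  simp [Config.next, hc.halted, hc.decision_of_injective hH hinj]

theorem IsActive.mem_range_pos_next [Nontrivial V] (hc : c.IsActive) (hH : H.graph.Preconnected)
    (hinj : Function.Injective c.pos) {h : V} (hh : (Set.range c.pos)ᶜ = {h}) :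
    h ∈ Set.range (c.next explorationAlgorithm H).pos := by
  have hhole : ∀ v, v ∉ Set.range c.pos ↔ v = h := Set.ext_iff.1 hh
  obtain ⟨v, hv⟩ := hH.exists_adj_of_nontrivial h
  obtain ⟨i, rfl⟩ : v ∈ Set.range c.pos := not_not.1 fun hocc => hv.ne' ((hhole v).1 hocc)
  obtain ⟨p, hp⟩ := Option.isSome_iff_exists.1 (isSome_holePort_viewAt hv.symm ((hhole h).2 rfl))
  refine ⟨i, ?_⟩
  simp only [Config.next, hc.halted, hc.decision_of_injective hH hinj, hp]
  exact (hhole _).1 (moveFrom_notMem_range_of_holePort_eq_some hp)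

end Config

theorem not_surjective_of_lt_card {V : Type*} {k : ℕ} (hk : k < ENat.card V) (f : Fin k → V) :
    ¬ Function.Surjective f := by
  intro hf
  have := Finite.of_surjective f hf
  rw [ENat.card_eq_coe_natCard, Nat.cast_lt] at hk
  exact hk.not_ge (by simpa using Nat.card_le_card_of_surjective f hf)

theorem exists_compl_range_eq_singleton {V : Type*} {k : ℕ} (hV : Nat.card V = k + 1)
    {f : Fin k → V} (hf : Function.Injective f) : ∃ h, (Set.range f)ᶜ = {h} := by
  have := Nat.finite_of_card_ne_zero (hV.trans_ne k.succ_ne_zero)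
  rw [← Set.ncard_eq_one, Set.ncard_compl, Set.ncard_range_of_injective hf, hV, Nat.card_fin,
    Nat.add_sub_cancel_left]

theorem DynamicGraph.IntervalConnected.preconnected {V : Type*} {G : DynamicGraph V} {T : ℕ}
    [NeZero T] (hG : G.IntervalConnected T) (r : ℕ) : (G r).graph.Preconnected :=
  ((hG r).mono (iInf_le _ (0 : Fin T))).preconnected

theorem DynamicGraph.intervalConnected_const {V : Type*} {H : PortGraph V} (hH : H.graph.Connected)
    (T : ℕ) : DynamicGraph.IntervalConnected (fun _ => H) T :=
  fun _ => hH.mono (le_iInf fun _ => le_rfl)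

/-- A locally finite graph with arbitrarily chosen port labels, to be used as a round of a dynamic
graph. -/
noncomputable def PortGraph.ofLocallyFinite {V : Type*} (G : SimpleGraph V) [G.LocallyFinite] :
    PortGraph V where
  graph := G
  nbrs v := (G.neighborFinset v).toList
  nodup_nbrs _ := Finset.nodup_toList _
  mem_nbrs v w := by simp

namespace explorationAlgorithm

open AgentAlgorithm

variable {V : Type*} {k : ℕ} {G : DynamicGraph V} {start : Fin k → V} {r s : ℕ}

theorem mem_run (G : DynamicGraph V) (start : Fin k → V) (r : ℕ) (i : Fin k) :
    (explorationAlgorithm.run G start r).mem i = Nat.bits (i + 1) := by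
  induction r with
  | zero => rfl
  | succ r ih =>
    have hkeep (m w l) : (explorationAlgorithm.compute m w l).mem = m := by
      simp only [explorationAlgorithm]
      split_ifs <;> rfl
    simp only [run, Config.next, Config.decision, hkeep, ih, ite_self]

theorem bits_run_le (G : DynamicGraph V) (start : Fin k → V) (r : ℕ) (i : Fin k) :
    (explorationAlgorithm.run G start r).bits i ≤ Nat.log 2 k + 2 := by
  have hi : (i : ℕ) + 1 < 2 ^ (Nat.log 2 k + 1) :=
    (Nat.succ_le_of_lt i.isLt).trans_lt (Nat.lt_pow_succ_log_self one_lt_two k)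
  rw [Config.bits, mem_run, Nat.size_eq_bits_len]
  exact Nat.succ_le_succ (Nat.size_le.2 hi)

/-- The rounds at whose beginning the agents are on pairwise distinct nodes. -/
def dispersedRounds (G : DynamicGraph V) (start : Fin k → V) : Set ℕ :=
  {r | Function.Injective (explorationAlgorithm.run G start r).pos}

theorem notMem_of_succ_mem_lowerBounds {S : Set ℕ} (hr : r + 1 ∈ lowerBounds S) : r ∉ S :=
  fun h => r.lt_irrefl (hr h)

theorem mem_lowerBounds_of_succ {S : Set ℕ} (hr : r + 1 ∈ lowerBounds S) : r ∈ lowerBounds S :=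
  fun _ h => r.le_succ.trans (hr h)

theorem isActive_run (hG : G.IntervalConnected 1) (hr : r ∈ lowerBounds (dispersedRounds G start)) :
    (explorationAlgorithm.run G start r).IsActive := by
  induction r with
  | zero => exact ⟨fun _ => rfl, fun _ => rfl⟩
  | succ r ih =>
    exact (ih (mem_lowerBounds_of_succ hr)).next (hG.preconnected r)
      (notMem_of_succ_mem_lowerBounds hr)

theorem pos_run_succ (hG : G.IntervalConnected 1)
    (hr : r + 1 ∈ lowerBounds (dispersedRounds G start)) :
    (explorationAlgorithm.run G start (r + 1)).pos =
      (explorationAlgorithm.run G start r).dispPos (G r) :=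
  (isActive_run hG (mem_lowerBounds_of_succ hr)).pos_next (hG.preconnected r)
    (notMem_of_succ_mem_lowerBounds hr)

theorem runningTime_succ (hG : G.IntervalConnected 1) (hk0 : 0 < k)
    (hs : IsLeast (dispersedRounds G start) s) :
    explorationAlgorithm.RunningTime G start (s + 1) := by
  refine ⟨(isActive_run hG hs.2).halted_next (hG.preconnected s) hs.1, fun t ht => ?_⟩
  by_contra! hts
  have hactive := isActive_run hG fun q hq => (Nat.le_of_lt_succ hts).trans (hs.2 hq)
  exact Bool.false_ne_true ((hactive.halted ⟨0, hk0⟩).symm.trans (ht ⟨0, hk0⟩))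

section Dispersion

variable (hG : G.IntervalConnected 1) (hk : k < ENat.card V)
include hG hk

theorem holeReachable_run (r : ℕ) :
    DISP.HoleReachable ((explorationAlgorithm.run G start r).leaderReports (G r)) :=
  Config.holeReachable_leaderReports (hG.preconnected r) (not_surjective_of_lt_card hk _)

theorem lt_ncard_range_pos_run (hk0 : 0 < k) (hr : r ∈ lowerBounds (dispersedRounds G start)) :
    r < (Set.range (explorationAlgorithm.run G start r).pos).ncard := by
  induction r with
  | zero => exact (Set.ncard_pos (Set.toFinite _)).2 ⟨_, ⟨0, hk0⟩, rfl⟩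
  | succ r ih =>
    rw [pos_run_succ hG hr]
    exact (Nat.succ_le_of_lt (ih (mem_lowerBounds_of_succ hr))).trans_lt <|
      Set.ncard_lt_ncard (Config.range_pos_ssubset_range_dispPos (holeReachable_run hG hk r)
        (notMem_of_succ_mem_lowerBounds hr)) (Set.toFinite _)

theorem exists_isLeast_dispersedRounds (hk0 : 0 < k) (start : Fin k → V) :
    ∃ s < k, IsLeast (dispersedRounds G start) s := by
  have hlt {r : ℕ} (hr : r ∈ lowerBounds (dispersedRounds G start)) : r < k :=
    (lt_ncard_range_pos_run hG hk hk0 hr).trans_le <|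
      (Finite.card_range_le _).trans_eq (Nat.card_fin k)
  have hne : (dispersedRounds G start).Nonempty := by
    by_contra! hempty
    exact (hlt (r := k) (by simp [hempty])).false
  exact ⟨_, hlt (isLeast_csInf hne).2, isLeast_csInf hne⟩

theorem le_ncard_pos_run_preimage_add (v : V)
    (hr : r ∈ lowerBounds (dispersedRounds G fun _ : Fin k => v)) :
    k ≤ ((explorationAlgorithm.run G (fun _ : Fin k => v) r).pos ⁻¹' {v}).ncard + r := by
  induction r with
  | zero => simp [run]
  | succ r ih =>
    have hle := Config.ncard_pos_preimage_le (holeReachable_run (start := fun _ => v) hG hk r) v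
    have hih := ih (mem_lowerBounds_of_succ hr)
    rw [pos_run_succ hG hr]
    omega

theorem runningTime_of_start_const (hk0 : 0 < k) (v : V) :
    explorationAlgorithm.RunningTime G (fun _ : Fin k => v) k := by
  obtain ⟨s, hsk, hs⟩ := exists_isLeast_dispersedRounds hG hk hk0 fun _ => v
  have hle := le_ncard_pos_run_preimage_add hG hk v hs.2
  have hone : ((explorationAlgorithm.run G (fun _ : Fin k => v) s).pos ⁻¹' {v}).ncard ≤ 1 :=
    Set.ncard_le_one_iff_subsingleton.2 (Set.subsingleton_singleton.preimage hs.1)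
  obtain rfl : k = s + 1 := by omega
  exact runningTime_succ hG hk0 hs

end Dispersion

section LastRound

variable (hG : G.IntervalConnected 1) (hV : Nat.card V = k + 1) (hk0 : 0 < k)
  (hs : IsLeast (dispersedRounds G start) s)
include hG hV hk0 hs

theorem mem_range_pos_run_succ {v : V}
    (hv : v ∉ Set.range (explorationAlgorithm.run G start s).pos) :
    v ∈ Set.range (explorationAlgorithm.run G start (s + 1)).pos := by
  have := Nat.finite_of_card_ne_zero (hV.trans_ne k.succ_ne_zero)
  have := Finite.one_lt_card_iff_nontrivial.1 (by omega : 1 < Nat.card V)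
  obtain ⟨h, hh⟩ := exists_compl_range_eq_singleton hV hs.1
  obtain rfl : v = h := Set.ext_iff.1 hh v |>.1 hv
  exact (isActive_run hG hs.2).mem_range_pos_next (hG.preconnected s) hs.1 hh

theorem exploresBy_succ : explorationAlgorithm.ExploresBy G start (s + 1) := by
  intro v
  by_cases hv : v ∈ Set.range (explorationAlgorithm.run G start s).pos
  · exact ⟨s, s.le_succ, hv⟩
  · exact ⟨s + 1, le_rfl, mem_range_pos_run_succ hG hV hk0 hs hv⟩

end LastRound

end explorationAlgorithm

theorem natLog_add_two_le_three_mul_logb {k n : ℕ} (hn : 2 ≤ n) (hk : k ≤ n) :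
    ((Nat.log 2 k + 2 : ℕ) : ℝ) ≤ 3 * Real.logb 2 n := by
  have hlog : (Nat.log 2 n : ℝ) ≤ Real.logb 2 n := Real.natLog_le_logb n 2
  have hle : Nat.log 2 k + 2 ≤ 3 * Nat.log 2 n := by
    have := Nat.log_pos one_lt_two hn
    have := Nat.log_mono_right (b := 2) hk
    omega
  calc ((Nat.log 2 k + 2 : ℕ) : ℝ) ≤ 3 * Nat.log 2 n := by exact_mod_cast hle
    _ ≤ 3 * Real.logb 2 n := by gcongr

theorem mainTheorem3 :
    ∃ c C : ℝ, 0 < c ∧ 0 < C ∧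
      ∀ (n : ℕ), 2 ≤ n → ∀ (V : Type*) [Fintype V], Fintype.card V = n →
        -- exploration with termination, in `O(n)` rounds and with `O(log n)` bits per agent
        (∀ G : DynamicGraph V, G.IntervalConnected 1 → ∀ start : Fin (n - 1) → V,
          ∃ t : ℕ, explorationAlgorithm.RunningTime G start t ∧ (t : ℝ) ≤ C * n ∧
            explorationAlgorithm.ExploresBy G start t ∧
            (∀ (r : ℕ) (i : Fin (n - 1)),
              ((explorationAlgorithm.run G start r).bits i : ℝ) ≤ C * Real.logb 2 n) ∧
            -- in the last round the agents are dispersed, and they move into the remaining hole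
            ∃ s : ℕ, t = s + 1 ∧
              Function.Injective (explorationAlgorithm.run G start s).pos ∧
              ∀ v : V, (∀ i, (explorationAlgorithm.run G start s).pos i ≠ v) →
                ∃ i, (explorationAlgorithm.run G start (s + 1)).pos i = v) ∧
        -- in the worst case the number of rounds is also `Ω(n)`
        (∃ G : DynamicGraph V, G.IntervalConnected 1 ∧ ∃ (start : Fin (n - 1) → V) (t : ℕ),
          explorationAlgorithm.RunningTime G start t ∧ c * n ≤ (t : ℝ)) := by
  classical
  refine ⟨1 / 2, 3, by norm_num, by norm_num, fun n hn V _ hV => ?_⟩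
  have hk0 : 0 < n - 1 := by omega
  have hcard : Nat.card V = n - 1 + 1 := by rw [Nat.card_eq_fintype_card]; omega
  have hk : (n - 1 : ℕ) < ENat.card V := by
    rw [ENat.card_eq_coe_natCard, hcard]; exact_mod_cast Nat.lt_succ_self _
  refine ⟨fun G hG start => ?_, ?_⟩
  · obtain ⟨s, hsk, hs⟩ := explorationAlgorithm.exists_isLeast_dispersedRounds hG hk hk0 start
    refine ⟨s + 1, explorationAlgorithm.runningTime_succ hG hk0 hs, ?_,
      explorationAlgorithm.exploresBy_succ hG hcard hk0 hs, fun r i => ?_, s, rfl, hs.1,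
      fun v hv => explorationAlgorithm.mem_range_pos_run_succ hG hcard hk0 hs (by simpa using hv)⟩
    · exact_mod_cast (by omega : s + 1 ≤ 3 * n)
    · exact (Nat.cast_le.2 (explorationAlgorithm.bits_run_le G start r i)).trans
        (natLog_add_two_le_three_mul_logb hn n.pred_le)
  · have : Nonempty V := Fintype.card_pos_iff.1 (by omega)
    have hG := DynamicGraph.intervalConnected_const
      (H := PortGraph.ofLocallyFinite ⊤) (SimpleGraph.connected_top (V := V)) 1
    refine ⟨_, hG, _, n - 1,
      explorationAlgorithm.runningTime_of_start_const hG hk hk0 (Classical.arbitrary V), ?_⟩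
    have hle : (n : ℝ) ≤ 2 * (n - 1 : ℕ) := by exact_mod_cast (by omega : n ≤ 2 * (n - 1))
    linarith
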